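/- There are universal constants $c, C > 0$ such that the following holds. Let $K \ge 2$, let $G$ be an undirected graph on the set of arms $[K]$, and let $N_i$ be the set consisting of $i$ and its neighbours in $G$. For a mean vector $\mu \in [0,1]^K$, consider the following game. In each round $t = 1, 2, \dots$ a reward vector $r_t$ with independent coordinates $r_{t,i} \sim \mathcal N(\mu_i, 1/\sqrt 2)$ (variance $1/\sqrt2$) is drawn independently of the past. A possibly randomized algorithm, which may know $G$, picks an arm $i_t$ on the basis of what it did and observed in the earlier rounds. It then receives $r_{t,i_t}$ and observes $r_{t,j}$ for all $j \in N_{i_t}$. With $\mu^* = \max_i \mu_i$, its pseudo-regret is $\mathrm{Reg}_\mu(T) = \mu^* T - \mathbb E\big[\sum_{t=1}^T r_{t,i_t}\big]$. Let $I^* = \{i : \mu_i = \mu^*\}$ and $\Delta_i = \mu^* - \mu_i$. For $s \in \mathbb N$ let $\Delta_s = 2^{-s}$, $\Delta^s_i = \max(\Delta_s, \Delta_i)$ and $\Gamma_s = \{i \in [K] : \Delta_i \le 2 \Delta_s\}$. Let $D(s)$ be the value of the linear program $$\min_{x \in \mathbb R_{\ge 0}^K} \ \sum_{i \in [K]} \Delta^s_i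 x_i \quad \text{subject to} \quad \sum_{j \in N_i} x_j \ge \frac{1}{\Delta_s^2} \ \text{ for all } i \in \Gamma_s ,$$ and let $\Lambda_s(\mu)$ be the set of instances with means $\mu' \in [0,1]^K$ such that $\mu_i \le \mu'_i \le \mu_i + 2\Delta^s_i$ for all $i \in [K]$. Fix $\mu \in [0,1]^K$ and $s \in \mathbb{N}$ with $\mu_i \le 1 - 2\Delta_s$ for all $i \in I^*$. Then for every algorithm there is an instance $\mu' \in \Lambda_s(\mu)$ such that $$\mathrm{Reg}_{\mu'}(T) \ \ge\ c\, D(s) \qquad \text{for all integers } T \ge C \Big( \frac{D(s)}{\Delta_s} + \frac{1}{\Delta_s^2} \Big).$$ -/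

import Mathlib

open MeasureTheory ProbabilityTheory
open scoped NNReal

noncomputable section

namespace FeedbackGraph

/-! ### The instance, its gaps and the linear program -/

/-- The largest mean of an instance. -/
def bestMean {K : ℕ} (μ : Fin K → ℝ) : ℝ := ⨆ i, μ i

/-- The set of arms whose mean is the largest one. -/
def optimalArms {K : ℕ} (μ : Fin K → ℝ) : Set (Fin K) := {i | μ i = bestMean μ}

/-- The gap of an arm to the best mean. -/
def gap {K : ℕ} (μ : Fin K → ℝ) (i : Fin K) : ℝ := bestMean μ - μ i

/-- The scale `2 ^ (-s)` of phase `s`. -/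
def scale (s : ℕ) : ℝ := ((2 : ℝ) ^ s)⁻¹

/-- The gaps, clipped from below at the scale of phase `s`. -/
def clippedGap {K : ℕ} (μ : Fin K → ℝ) (s : ℕ) (i : Fin K) : ℝ := max (scale s) (gap μ i)

/-- The arms whose gap is at most twice the scale of phase `s`. -/
def nearOptimal {K : ℕ} (μ : Fin K → ℝ) (s : ℕ) : Set (Fin K) := {i | gap μ i ≤ 2 * scale s}

open Classical in
/-- The neighbourhood of an arm; every vertex carries a self-loop, so the arm itself belongs to
it (a `SimpleGraph` records only the edges between distinct vertices). -/
def nbhd {K : ℕ} (G : SimpleGraph (Fin K)) (i : Fin K) : Finset (Fin K) :=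
  Finset.univ.filter fun j => j = i ∨ G.Adj i j

/-- The feasible points of the linear program of phase `s`. -/
def lpFeasible {K : ℕ} (G : SimpleGraph (Fin K)) (μ : Fin K → ℝ) (s : ℕ) : Set (Fin K → ℝ) :=
  {x | (∀ i, 0 ≤ x i) ∧ ∀ i ∈ nearOptimal μ s, 1 / scale s ^ 2 ≤ ∑ j ∈ nbhd G i, x j}

/-- The value of the linear program of phase `s`: minimize the inner product of `x` with the
clipped gaps over the feasible points. -/
def lpValue {K : ℕ} (G : SimpleGraph (Fin K)) (μ : Fin K → ℝ) (s : ℕ) : ℝ :=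
  sInf ((fun x : Fin K → ℝ => ∑ i, clippedGap μ s i * x i) '' lpFeasible G μ s)

/-- The confusing instances around `μ`: mean vectors in `[0, 1]^K` that lie in the box
`μ + ∏ i, [0, 2 * clippedGap μ s i]`. -/
def confusing {K : ℕ} (μ : Fin K → ℝ) (s : ℕ) : Set (Fin K → ℝ) :=
  {μ' | (∀ i, μ' i ∈ Set.Icc (0 : ℝ) 1) ∧
    ∀ i, μ' i ∈ Set.Icc (μ i) (μ i + 2 * clippedGap μ s i)}

/-! ### The interaction -/

/-- What the learner records in one round: the arm that was played, and the vector of the observed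
rewards, in which the coordinates that are not observed are filled with `0`. (The set of observed
coordinates is determined by the arm.) -/
abbrev Round (K : ℕ) : Type := Fin K × (Fin K → ℝ)

/-- What the learner has recorded in the first `t` rounds. -/
abbrev History (K t : ℕ) : Type := Fin t → Round K

/-- A (randomized) algorithm: for each `t`, the conditional law of the next arm given what was
recorded in the first `t` rounds. -/
structure Algorithm (K : ℕ) where
  choice : (t : ℕ) → Kernel (History K t) (Fin K)
  isMarkov : ∀ t, IsMarkovKernel (choice t)

/-- The law of the vector of all rewards of one round: independent Gaussians with means `μ i` and
variance `1 / √2`. -/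
def rewardLaw {K : ℕ} (μ : Fin K → ℝ) : Measure (Fin K → ℝ) :=
  Measure.pi fun i => gaussianReal (μ i) (NNReal.sqrt 2)⁻¹

/-- The rewards that are observed when arm `i` is played. -/
def observe {K : ℕ} (G : SimpleGraph (Fin K)) (i : Fin K) (r : Fin K → ℝ) : Fin K → ℝ :=
  fun j => if j ∈ nbhd G i then r j else 0

/-- The law of the observed rewards, given the arm that is played. -/
def feedback {K : ℕ} (G : SimpleGraph (Fin K)) (μ : Fin K → ℝ) : Kernel (Fin K) (Fin K → ℝ) :=
  Kernel.ofFunOfCountable fun i => (rewardLaw μ).map (observe G i)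

/-- The law of what is recorded in the first `t` rounds when algorithm `A` plays on the instance
`μ`: given the history, draw the arm from `A`, then fresh rewards, and append the outcome. -/
def law {K : ℕ} (G : SimpleGraph (Fin K)) (μ : Fin K → ℝ) (A : Algorithm K) :
    (t : ℕ) → Measure (History K t)
  | 0 => Measure.dirac Fin.elim0
  | t + 1 =>
    (law G μ A t ⊗ₘ (A.choice t ⊗ₖ (feedback G μ).prodMkLeft (History K t))).map
      fun p => (Fin.snoc p.1 p.2 : History K (t + 1))

/-- The pseudo-regret after `T` rounds: `T` times the best mean, minus the expected sum of the
rewards of the arms that were played. -/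
def regret {K : ℕ} (G : SimpleGraph (Fin K)) (μ : Fin K → ℝ) (A : Algorithm K) (T : ℕ) : ℝ :=
  T * bestMean μ - ∫ h, ∑ t, (h t).2 (h t).1 ∂(law G μ A T)

/-! ### The objects above are well defined -/

theorem scale_pos (s : ℕ) : 0 < scale s := by unfold scale; positivity

theorem lpFeasible_nonempty {K : ℕ} (G : SimpleGraph (Fin K)) (μ : Fin K → ℝ) (s : ℕ) :
    (lpFeasible G μ s).Nonempty := by
  have h0 : (0 : ℝ) ≤ 1 / scale s ^ 2 := by positivity
  refine ⟨fun _ => 1 / scale s ^ 2, fun _ => h0, fun i _ => ?_⟩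
  exact Finset.single_le_sum (f := fun _ : Fin K => 1 / scale s ^ 2) (fun _ _ => h0)
    (show i ∈ nbhd G i by simp [nbhd])

theorem lp_bddBelow {K : ℕ} (G : SimpleGraph (Fin K)) (μ : Fin K → ℝ) (s : ℕ) :
    BddBelow ((fun x : Fin K → ℝ => ∑ i, clippedGap μ s i * x i) '' lpFeasible G μ s) := by
  refine ⟨0, ?_⟩
  rintro _ ⟨x, hx, rfl⟩
  exact Finset.sum_nonneg fun i _ =>
    mul_nonneg ((scale_pos s).le.trans (le_max_left _ _)) (hx.1 i)

theorem measurable_observe {K : ℕ} (G : SimpleGraph (Fin K)) (i : Fin K) :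
    Measurable (observe G i) := by
  refine measurable_pi_lambda _ fun j => ?_
  unfold observe
  split_ifs
  · exact measurable_pi_apply j
  · exact measurable_const

theorem measurable_snoc (K t : ℕ) :
    Measurable fun p : History K t × Round K => (Fin.snoc p.1 p.2 : History K (t + 1)) := by
  refine measurable_pi_lambda _ fun j => ?_
  induction j using Fin.lastCases with
  | last => simpa using measurable_snd
  | cast j =>
    simp only [Fin.snoc_castSucc]
    exact (measurable_pi_apply j).comp measurable_fst

instance isProbabilityMeasure_rewardLaw {K : ℕ} (μ : Fin K → ℝ) :
    IsProbabilityMeasure (rewardLaw μ) := by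
  unfold rewardLaw; infer_instance

instance isMarkovKernel_feedback {K : ℕ} (G : SimpleGraph (Fin K)) (μ : Fin K → ℝ) :
    IsMarkovKernel (feedback G μ) :=
  ⟨fun i => Measure.isProbabilityMeasure_map (measurable_observe G i).aemeasurable⟩

theorem isProbabilityMeasure_law {K : ℕ} (G : SimpleGraph (Fin K)) (μ : Fin K → ℝ)
    (A : Algorithm K) (t : ℕ) : IsProbabilityMeasure (law G μ A t) := by
  induction t with
  | zero => unfold law; infer_instance
  | succ t ih =>
    have := A.isMarkov t
    exact Measure.isProbabilityMeasure_map (measurable_snoc K t).aemeasurable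

end FeedbackGraph

end

noncomputable section

namespace FeedbackGraph

/-! ### Change of measure -/

/-! Write `Δ` for `scale s` and `D` for `lpValue G μ s`. Regret is the expected sum of the gaps of
the played arms, hence nondecreasing in the horizon (`monotone_regret`). A bound at one horizon
therefore serves all later ones, and the instance can be chosen before `T`.

If `D > 2 / Δ`, raise an optimal arm `b` by `Δ / 2`. In this instance the gaps of the other arms are
at least half their clipped gaps. Small regret would make the expected play counts so cheap outside
`b` that nine times these counts, with `1 / Δ ^ 2` put on `b`, costs less than `D` and so is
infeasible. Hence some near-optimal `i` is observed at most `1 / (9 * Δ ^ 2)` times in expectation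
(`exists_undersampled`). Raise `i` by at most `3 * Δ` to make it the best arm by `Δ / 2`. The
learner can hardly notice (`law_update_real_ge`): with constant probability it still plays `i` at
most half the time, and at a horizon of at least `D / Δ` this costs order `D`.

If `D ≤ 2 / Δ`, regret of order `1 / Δ` suffices. The classical two-point argument gives it at
horizon `1 / Δ ^ 2`, under any feedback graph.

Indistinguishability is proved directly from the likelihood ratio rather than through relative
entropy. -/

theorem gaussianReal_add_eq_withDensity (m δ : ℝ) :
    gaussianReal (m + δ) (NNReal.sqrt 2)⁻¹ = (gaussianReal m (NNReal.sqrt 2)⁻¹).withDensity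
      fun x => ENNReal.ofReal (Real.exp (δ * √2 * (x - m) - δ ^ 2 * √2 / 2)) := by
  have hv : (NNReal.sqrt 2)⁻¹ ≠ 0 := by simp
  rw [gaussianReal_of_var_ne_zero _ hv, gaussianReal_of_var_ne_zero _ hv,
    ← withDensity_mul _ (by fun_prop) (by fun_prop)]
  congr 1
  ext x
  simp only [gaussianPDF, Pi.mul_apply]
  rw [← ENNReal.ofReal_mul (gaussianPDFReal_nonneg _ _ _)]
  congr 1
  simp only [gaussianPDFReal, mul_assoc]
  rw [← Real.exp_add]
  congr 2
  have h2 : √(2 : ℝ) ≠ 0 := by positivity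
  have hs : ((NNReal.sqrt 2 : ℝ≥0) : ℝ) = √2 := by simp
  simp only [NNReal.coe_inv, hs]
  field_simp
  ring

/-- On a box, the indicator times the density is a product of functions of single coordinates, so
independence factors the integral. Boxes determine the product measure. -/
theorem pi_eq_withDensity_eval {ι : Type*} [Fintype ι] (m m' : ι → Measure ℝ)
    [∀ j, IsProbabilityMeasure (m j)] [∀ j, IsProbabilityMeasure (m' j)] (i : ι)
    {l : ℝ → ENNReal} (hl : Measurable l) (hi : m' i = (m i).withDensity l)
    (hj : ∀ j, j ≠ i → m' j = m j) :
    Measure.pi m' = (Measure.pi m).withDensity fun x => l (x i) := by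
  classical
  refine Measure.pi_eq fun s hs => ?_
  rw [withDensity_apply _ (MeasurableSet.univ_pi hs), ← lintegral_indicator (MeasurableSet.univ_pi hs)]
  set X : ι → ℝ → ENNReal := fun j => (s j).indicator (if j = i then l else 1) with hX
  have hXm : ∀ j, Measurable (X j) := by
    intro j
    refine Measurable.indicator ?_ (hs j)
    split_ifs
    · exact hl
    · exact measurable_const
  have hprod : ∀ x : ι → ℝ, (Set.univ.pi s).indicator (fun x => l (x i)) x = ∏ j, X j (x j) := by
    intro x
    by_cases hx : x ∈ Set.univ.pi s
    · rw [Set.indicator_of_mem hx]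
      have : ∀ j, X j (x j) = if j = i then l (x j) else 1 := by
        intro j
        simp only [hX]
        rw [Set.indicator_of_mem (hx j trivial)]
        split_ifs <;> rfl
      simp [this]
    · rw [Set.indicator_of_notMem hx]
      obtain ⟨j, hj⟩ : ∃ j, x j ∉ s j := by simpa using hx
      exact (Finset.prod_eq_zero (Finset.mem_univ j) (Set.indicator_of_notMem hj _)).symm
  simp_rw [hprod]
  rw [lintegral_prod_eq_prod_lintegral_of_indepFun Finset.univ (fun j (x : ι → ℝ) => X j (x j))
    (iIndepFun_pi fun j => (hXm j).aemeasurable) fun j => (hXm j).comp (measurable_pi_apply j)]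
  refine Finset.prod_congr rfl fun j _ => ?_
  have he := (measurePreserving_eval m j).lintegral_comp (hXm j)
  simp only [Function.eval] at he
  rw [he]
  simp only [hX]
  rw [lintegral_indicator (hs j)]
  split_ifs with h
  · subst h
    rw [hi, withDensity_apply _ (hs j)]
  · simp [hj j h]

/-- Masking acts on each coordinate separately, so independence survives it. In this form a change
of one mean touches one factor only. -/
theorem feedback_apply {K : ℕ} (G : SimpleGraph (Fin K)) (μ : Fin K → ℝ) (a : Fin K) :
    feedback G μ a = Measure.pi fun j =>
      if j ∈ nbhd G a then gaussianReal (μ j) (NNReal.sqrt 2)⁻¹ else Measure.dirac 0 := by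
  classical
  let f : Fin K → ℝ → ℝ := fun j => if j ∈ nbhd G a then id else fun _ => 0
  have hf : ∀ j, Measurable (f j) := by
    intro j
    simp only [f]
    split_ifs
    · exact measurable_id
    · exact measurable_const
  have hobs : observe G a = fun r j => f j (r j) := by
    ext r j
    simp only [observe, f]
    split_ifs <;> rfl
  have hprob : ∀ j, IsProbabilityMeasure ((gaussianReal (μ j) (NNReal.sqrt 2)⁻¹).map (f j)) :=
    fun j => Measure.isProbabilityMeasure_map (hf j).aemeasurable
  change (rewardLaw μ).map (observe G a) = _
  rw [hobs, rewardLaw, Measure.pi_map_pi fun j => (hf j).aemeasurable]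
  congr 1
  ext1 j
  simp only [f]
  split_ifs
  · simp
  · simp

/-- The contribution of one round to the log-likelihood ratio of the instance in which the mean
`m` of arm `i` is raised by `δ`. -/
def logRatio {K : ℕ} (G : SimpleGraph (Fin K)) (i : Fin K) (m δ : ℝ) (p : Round K) : ℝ :=
  open Classical in
  if i ∈ nbhd G p.1 then δ * √2 * (p.2 i - m) - δ ^ 2 * √2 / 2 else 0

theorem measurable_logRatio {K : ℕ} (G : SimpleGraph (Fin K)) (i : Fin K) (m δ : ℝ) :
    Measurable (logRatio G i m δ) := by
  classical
  unfold logRatio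
  refine Measurable.ite ?_ ?_ measurable_const
  · exact measurable_fst (Set.Finite.measurableSet (Set.toFinite {a | i ∈ nbhd G a}))
  · have : Measurable fun p : Round K => p.2 i := (measurable_pi_apply i).comp measurable_snd
    fun_prop

theorem lintegral_feedback_update {K : ℕ} (G : SimpleGraph (Fin K)) (μ : Fin K → ℝ)
    (i : Fin K) (δ : ℝ) (a : Fin K) {g : (Fin K → ℝ) → ENNReal} (hg : Measurable g) :
    ∫⁻ o, g o ∂(feedback G (Function.update μ i (μ i + δ)) a) =
      ∫⁻ o, g o * ENNReal.ofReal (Real.exp (logRatio G i (μ i) δ (a, o))) ∂(feedback G μ a) := by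
  classical
  have hp : ∀ (μ : Fin K → ℝ) (j : Fin K), IsProbabilityMeasure
      (if j ∈ nbhd G a then gaussianReal (μ j) (NNReal.sqrt 2)⁻¹ else Measure.dirac 0) := by
    intro μ j
    split_ifs <;> infer_instance
  by_cases ha : i ∈ nbhd G a
  · simp only [logRatio, if_pos ha]
    rw [feedback_apply, feedback_apply]
    have := hp μ
    have := hp (Function.update μ i (μ i + δ))
    rw [pi_eq_withDensity_eval (fun j => if j ∈ nbhd G a then
        gaussianReal (μ j) (NNReal.sqrt 2)⁻¹ else Measure.dirac 0) _ i
        (l := fun x => ENNReal.ofReal (Real.exp (δ * √2 * (x - μ i) - δ ^ 2 * √2 / 2)))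
        (by fun_prop) (by simpa [ha] using gaussianReal_add_eq_withDensity (μ i) δ)
        (by intro j hj; simp [hj])]
    rw [lintegral_withDensity_eq_lintegral_mul _ (by fun_prop) hg]
    simp [mul_comm]
  · simp only [logRatio, if_neg ha, Real.exp_zero, ENNReal.ofReal_one, mul_one]
    rw [feedback_apply, feedback_apply]
    congr 2
    ext1 j
    by_cases hj : j = i
    · subst hj; simp [ha]
    · simp [hj]

instance isProbabilityMeasure_law_inst {K : ℕ} (G : SimpleGraph (Fin K)) (μ : Fin K → ℝ)
    (A : Algorithm K) (t : ℕ) : IsProbabilityMeasure (law G μ A t) :=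
  isProbabilityMeasure_law G μ A t

instance isMarkovKernel_choice {K : ℕ} (A : Algorithm K) (t : ℕ) : IsMarkovKernel (A.choice t) :=
  A.isMarkov t

theorem lintegral_law_succ {K : ℕ} (G : SimpleGraph (Fin K)) (μ : Fin K → ℝ) (A : Algorithm K)
    (t : ℕ) {F : History K (t + 1) → ENNReal} (hF : Measurable F) :
    ∫⁻ h, F h ∂(law G μ A (t + 1)) =
      ∫⁻ h, ∫⁻ a, ∫⁻ o, F (Fin.snoc h (a, o) : History K (t + 1)) ∂(feedback G μ a)
        ∂(A.choice t h) ∂(law G μ A t) := by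
  have hF' := hF.comp (measurable_snoc K t)
  rw [law, lintegral_map hF (measurable_snoc K t)]
  rw [Measure.lintegral_compProd (by exact hF')]
  refine lintegral_congr fun h => ?_
  rw [Kernel.lintegral_compProd _ _ _ (by exact hF'.comp measurable_prodMk_left)]
  rfl

/-- The log-likelihood ratio of a history, for the instance in which the mean `m` of arm `i` is
raised by `δ`. -/
def historyLogRatio {K t : ℕ} (G : SimpleGraph (Fin K)) (i : Fin K) (m δ : ℝ)
    (h : History K t) : ℝ :=
  ∑ u, logRatio G i m δ (h u)

theorem measurable_historyLogRatio {K t : ℕ} (G : SimpleGraph (Fin K)) (i : Fin K) (m δ : ℝ) :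
    Measurable (historyLogRatio (t := t) G i m δ) :=
  Finset.measurable_fun_sum _ fun u _ =>
    (measurable_logRatio G i m δ).comp (measurable_pi_apply u)

/-- The algorithm uses the same choice kernels in both instances, so only the feedback contributes
to the likelihood ratio, one factor per round. -/
theorem lintegral_law_update {K : ℕ} (G : SimpleGraph (Fin K)) (μ : Fin K → ℝ) (A : Algorithm K)
    (i : Fin K) (δ : ℝ) (t : ℕ) {F : History K t → ENNReal} (hF : Measurable F) :
    ∫⁻ h, F h ∂(law G (Function.update μ i (μ i + δ)) A t) =
      ∫⁻ h, F h * ENNReal.ofReal (Real.exp (historyLogRatio G i (μ i) δ h)) ∂(law G μ A t) := by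
  induction t with
  | zero => simp [law, historyLogRatio]
  | succ t ih =>
    have hR := (measurable_historyLogRatio (t := t + 1) G i (μ i) δ).exp.ennreal_ofReal
    have hs : ∀ (h : History K t) (a : Fin K), Measurable fun o : Fin K → ℝ =>
        (Fin.snoc h (a, o) : History K (t + 1)) := fun h a =>
      (measurable_snoc K t).comp (measurable_prodMk_left.comp measurable_prodMk_left)
    have hl : Measurable fun p : (History K t × Fin K) × (Fin K → ℝ) =>
        ENNReal.ofReal (Real.exp (logRatio G i (μ i) δ (p.1.2, p.2))) :=
      ((measurable_logRatio G i (μ i) δ).comp (by fun_prop)).exp.ennreal_ofReal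
    have hFs : Measurable fun p : (History K t × Fin K) × (Fin K → ℝ) =>
        F (Fin.snoc p.1.1 (p.1.2, p.2) : History K (t + 1)) :=
      (hF.comp (measurable_snoc K t)).comp (g := F ∘ _)
        (f := fun p : (History K t × Fin K) × (Fin K → ℝ) => (p.1.1, (p.1.2, p.2))) (by fun_prop)
    have hin : Measurable fun p : History K t × Fin K => ∫⁻ o,
        F (Fin.snoc p.1 (p.2, o) : History K (t + 1)) *
          ENNReal.ofReal (Real.exp (logRatio G i (μ i) δ (p.2, o))) ∂(feedback G μ p.2) :=
      Measurable.lintegral_kernel_prod_right' (κ := (feedback G μ).prodMkLeft (History K t))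
        (hFs.mul hl)
    rw [lintegral_law_succ _ _ _ _ hF,
      lintegral_law_succ _ _ _ _ (F := fun h => F h * _) (hF.mul hR)]
    simp_rw [fun (h : History K t) a => lintegral_feedback_update G μ i δ a
      (g := fun o => F (Fin.snoc h (a, o) : History K (t + 1))) (hF.comp (hs h a))]
    rw [ih (Measurable.lintegral_kernel_prod_right' hin)]
    refine lintegral_congr fun h => ?_
    rw [← lintegral_mul_const _ (by exact hin.comp measurable_prodMk_left)]
    refine lintegral_congr fun a => ?_
    rw [← lintegral_mul_const _ (by
      exact (hFs.mul hl).comp (measurable_prodMk_left (x := (h, a))))]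
    refine lintegral_congr fun o => ?_
    rw [mul_assoc, ← ENNReal.ofReal_mul (Real.exp_nonneg _), ← Real.exp_add]
    congr 3
    simp [historyLogRatio, Fin.sum_univ_castSucc, add_comm]

/-! ### Sums over the arms that were played -/

/-- The sum over the rounds of the value of `f` at the arm that was played. -/
def armSum {K t : ℕ} (f : Fin K → ℝ) (h : History K t) : ℝ := ∑ u, f (h u).1

theorem measurable_armSum {K t : ℕ} (f : Fin K → ℝ) : Measurable (armSum (t := t) f) :=
  Finset.measurable_fun_sum _ fun u _ =>
    (measurable_of_finite f).comp (measurable_fst.comp (measurable_pi_apply u))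

theorem armSum_mono {K t : ℕ} {f g : Fin K → ℝ} (hfg : ∀ i, f i ≤ g i) (h : History K t) :
    armSum f h ≤ armSum g h :=
  Finset.sum_le_sum fun _ _ => hfg _

theorem armSum_nonneg {K t : ℕ} {f : Fin K → ℝ} (hf : ∀ i, 0 ≤ f i) (h : History K t) :
    0 ≤ armSum f h :=
  Finset.sum_nonneg fun _ _ => hf _

theorem abs_armSum_le {K t : ℕ} (f : Fin K → ℝ) (h : History K t) :
    |armSum f h| ≤ t * ∑ i, |f i| := by
  calc |armSum f h| ≤ ∑ u, |f (h u).1| := Finset.abs_sum_le_sum_abs _ _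
    _ ≤ ∑ _u : Fin t, ∑ i, |f i| := Finset.sum_le_sum fun u _ =>
        Finset.single_le_sum (f := fun i => |f i|) (fun _ _ => abs_nonneg _) (Finset.mem_univ _)
    _ = t * ∑ i, |f i| := by simp

theorem integrable_armSum {K t : ℕ} (f : Fin K → ℝ) (P : Measure (History K t))
    [IsFiniteMeasure P] : Integrable (armSum f) P :=
  Integrable.of_bound (measurable_armSum f).aestronglyMeasurable (t * ∑ i, |f i|)
    (ae_of_all _ fun h => abs_armSum_le f h)

open Classical in
/-- The number of times that an arm of `S` was played. -/
def playCount {K t : ℕ} (S : Set (Fin K)) (h : History K t) : ℝ :=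
  armSum (fun a => if a ∈ S then 1 else 0) h

theorem measurable_playCount {K t : ℕ} (S : Set (Fin K)) : Measurable (playCount (t := t) S) :=
  measurable_armSum _

theorem integrable_playCount {K t : ℕ} (S : Set (Fin K)) (P : Measure (History K t))
    [IsFiniteMeasure P] : Integrable (playCount S) P :=
  integrable_armSum _ P

theorem playCount_nonneg {K t : ℕ} (S : Set (Fin K)) (h : History K t) : 0 ≤ playCount S h :=
  armSum_nonneg (fun _ => by split_ifs <;> norm_num) h

theorem playCount_le {K t : ℕ} (S : Set (Fin K)) (h : History K t) : playCount S h ≤ t :=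
  calc playCount S h ≤ armSum (fun _ => 1) h :=
        armSum_mono (fun _ => by split_ifs <;> norm_num) h
    _ = t := by simp [armSum]

theorem armSum_eq_sum_playCount {K t : ℕ} (f : Fin K → ℝ) (h : History K t) :
    armSum f h = ∑ i, f i * playCount {i} h := by
  simp only [playCount, armSum, Finset.mul_sum]
  rw [Finset.sum_comm]
  simp

theorem integral_armSum {K t : ℕ} (f : Fin K → ℝ) (P : Measure (History K t))
    [IsFiniteMeasure P] : ∫ h, armSum f h ∂P = ∑ i, f i * ∫ h, playCount {i} h ∂P := by
  simp_rw [armSum_eq_sum_playCount f]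
  rw [integral_finsetSum _ fun i _ => (integrable_playCount _ P).const_mul _]
  simp_rw [integral_const_mul]

theorem integral_playCount_coe {K t : ℕ} (S : Finset (Fin K)) (P : Measure (History K t))
    [IsFiniteMeasure P] : ∫ h, playCount S h ∂P = ∑ i ∈ S, ∫ h, playCount {i} h ∂P := by
  change ∫ h, armSum _ h ∂P = _
  rw [integral_armSum]
  simp

/-! ### The regret in terms of the arms that were played -/

theorem measurable_init (K t : ℕ) :
    Measurable fun (h : History K (t + 1)) (u : Fin t) => h u.castSucc :=
  measurable_pi_lambda _ fun u => measurable_pi_apply u.castSucc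

theorem measurePreserving_init {K : ℕ} (G : SimpleGraph (Fin K)) (μ : Fin K → ℝ)
    (A : Algorithm K) (t : ℕ) :
    MeasurePreserving (fun (h : History K (t + 1)) (u : Fin t) => h u.castSucc)
      (law G μ A (t + 1)) (law G μ A t) := by
  refine ⟨measurable_init K t, ?_⟩
  rw [law, Measure.map_map (measurable_init K t) (measurable_snoc K t)]
  have : (fun (h : History K (t + 1)) (u : Fin t) => h u.castSucc) ∘
      (fun p : History K t × Round K => (Fin.snoc p.1 p.2 : History K (t + 1))) = Prod.fst := by
    ext p u : 2
    simp
  rw [this]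
  exact Measure.fst_compProd _ _

theorem measurable_lastReward (K t : ℕ) :
    Measurable fun h : History K (t + 1) => (h (Fin.last t)).2 (h (Fin.last t)).1 := by
  have : Measurable fun p : Round K => p.2 p.1 :=
    measurable_from_prod_countable_right fun a => measurable_pi_apply a
  exact this.comp (measurable_pi_apply _)

/-- The self-loop guarantees that the reward of the played arm is recorded and not masked by `0`. -/
theorem feedback_map_eval {K : ℕ} (G : SimpleGraph (Fin K)) (μ : Fin K → ℝ) (a : Fin K) :
    (feedback G μ a).map (fun o => o a) = gaussianReal (μ a) (NNReal.sqrt 2)⁻¹ := by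
  change ((rewardLaw μ).map (observe G a)).map (fun o => o a) = _
  rw [Measure.map_map (measurable_pi_apply a) (measurable_observe G a)]
  have : (fun o : Fin K → ℝ => o a) ∘ observe G a = Function.eval a := by
    ext r
    simp [observe, nbhd]
  rw [this]
  exact (measurePreserving_eval _ a).map_eq

theorem integrable_feedback_eval {K : ℕ} (G : SimpleGraph (Fin K)) (μ : Fin K → ℝ) (a : Fin K) :
    Integrable (fun o => o a) (feedback G μ a) := by
  have h : Integrable id ((feedback G μ a).map fun o => o a) := by
    rw [feedback_map_eval]
    exact (memLp_id_gaussianReal 1).integrable (by simp)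
  exact (integrable_map_measure aestronglyMeasurable_id (measurable_pi_apply a).aemeasurable).1 h

theorem integral_feedback_eval {K : ℕ} (G : SimpleGraph (Fin K)) (μ : Fin K → ℝ) (a : Fin K) :
    ∫ o, o a ∂(feedback G μ a) = μ a := by
  have h : ∫ x, id x ∂((feedback G μ a).map fun o => o a) = μ a := by
    rw [feedback_map_eval]
    exact integral_id_gaussianReal
  rwa [integral_map (φ := fun o : Fin K → ℝ => o a)
    (measurable_pi_apply a).aemeasurable aestronglyMeasurable_id] at h

theorem integrable_lastReward {K : ℕ} (G : SimpleGraph (Fin K)) (μ : Fin K → ℝ)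
    (A : Algorithm K) (t : ℕ) :
    Integrable (fun h : History K (t + 1) => (h (Fin.last t)).2 (h (Fin.last t)).1)
      (law G μ A (t + 1)) := by
  have hm := measurable_lastReward K t
  refine ⟨hm.aestronglyMeasurable, ?_⟩
  rw [HasFiniteIntegral, lintegral_law_succ G μ A t hm.enorm]
  simp only [Fin.snoc_last]
  set C : ENNReal := ∑ a, ∫⁻ o, ‖o a‖ₑ ∂(feedback G μ a)
  have hC : C < ⊤ := ENNReal.sum_lt_top.2 fun a _ => (integrable_feedback_eval G μ a).2
  refine lt_of_le_of_lt ?_ hC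
  calc ∫⁻ h, ∫⁻ a, ∫⁻ o, ‖o a‖ₑ ∂(feedback G μ a) ∂(A.choice t h) ∂(law G μ A t)
      ≤ ∫⁻ h, ∫⁻ _a, C ∂(A.choice t h) ∂(law G μ A t) := by
        gcongr with h a
        exact Finset.single_le_sum (f := fun a => ∫⁻ o : Fin K → ℝ, ‖o a‖ₑ ∂(feedback G μ a))
          (fun _ _ => zero_le) (Finset.mem_univ a)
    _ = C := by simp

theorem integral_law_succ {K : ℕ} (G : SimpleGraph (Fin K)) (μ : Fin K → ℝ) (A : Algorithm K)
    (t : ℕ) {F : History K (t + 1) → ℝ} (hm : Measurable F)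
    (hF : Integrable F (law G μ A (t + 1))) :
    ∫ h, F h ∂(law G μ A (t + 1)) =
      ∫ h, ∫ p, F (Fin.snoc h p : History K (t + 1))
        ∂((A.choice t ⊗ₖ (feedback G μ).prodMkLeft (History K t)) h) ∂(law G μ A t) := by
  rw [law] at hF ⊢
  rw [integral_map (measurable_snoc K t).aemeasurable hm.aestronglyMeasurable]
  exact Measure.integral_compProd
    ((integrable_map_measure hm.aestronglyMeasurable (measurable_snoc K t).aemeasurable).1 hF)

theorem integral_lastReward {K : ℕ} (G : SimpleGraph (Fin K)) (μ : Fin K → ℝ)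
    (A : Algorithm K) (t : ℕ) :
    ∫ h, (h (Fin.last t)).2 (h (Fin.last t)).1 ∂(law G μ A (t + 1)) =
      ∫ h, μ (h (Fin.last t)).1 ∂(law G μ A (t + 1)) := by
  have hmm : Measurable fun h : History K (t + 1) => μ (h (Fin.last t)).1 :=
    (measurable_of_finite μ).comp (measurable_fst.comp (measurable_pi_apply _))
  have hmi : Integrable (fun h : History K (t + 1) => μ (h (Fin.last t)).1)
      (law G μ A (t + 1)) :=
    Integrable.of_bound hmm.aestronglyMeasurable (∑ i, |μ i|) (ae_of_all _ fun h =>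
      Finset.single_le_sum (f := fun i => |μ i|) (fun _ _ => abs_nonneg _) (Finset.mem_univ _))
  rw [integral_law_succ G μ A t (measurable_lastReward K t) (integrable_lastReward G μ A t),
    integral_law_succ G μ A t hmm hmi]
  simp only [Fin.snoc_last]
  refine integral_congr_ae (ae_of_all _ fun h => ?_)
  have hm1 : Measurable fun p : Round K => p.2 p.1 :=
    measurable_from_prod_countable_right fun a => measurable_pi_apply a
  have hint : Integrable (fun p : Round K => p.2 p.1)
      ((A.choice t ⊗ₖ (feedback G μ).prodMkLeft (History K t)) h) := by
    refine (ProbabilityTheory.integrable_compProd_iff hm1.aestronglyMeasurable).2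
      ⟨ae_of_all _ fun a => integrable_feedback_eval G μ a, Integrable.of_finite⟩
  have hint2 : Integrable (fun p : Round K => μ p.1)
      ((A.choice t ⊗ₖ (feedback G μ).prodMkLeft (History K t)) h) :=
    Integrable.of_bound ((measurable_of_finite μ).comp measurable_fst).aestronglyMeasurable
      (∑ i, |μ i|) (ae_of_all _ fun p =>
      Finset.single_le_sum (f := fun i => |μ i|) (fun _ _ => abs_nonneg _) (Finset.mem_univ _))
  simp only
  rw [ProbabilityTheory.integral_compProd hint, ProbabilityTheory.integral_compProd hint2]
  refine integral_congr_ae (ae_of_all _ fun a => ?_)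
  simp only [Kernel.prodMkLeft_apply, integral_const, probReal_univ, one_smul]
  exact integral_feedback_eval G μ a

theorem integral_armSum_succ {K : ℕ} (G : SimpleGraph (Fin K)) (μ : Fin K → ℝ)
    (A : Algorithm K) (t : ℕ) (f : Fin K → ℝ) :
    Integrable (fun h : History K (t + 1) => f (h (Fin.last t)).1) (law G μ A (t + 1)) ∧
    ∫ h, armSum f h ∂(law G μ A (t + 1)) =
      ∫ h, armSum f h ∂(law G μ A t) + ∫ h, f (h (Fin.last t)).1 ∂(law G μ A (t + 1)) := by
  have hmp := measurePreserving_init G μ A t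
  have hi : Integrable (fun h : History K (t + 1) => f (h (Fin.last t)).1)
      (law G μ A (t + 1)) :=
    Integrable.of_bound ((measurable_of_finite f).comp
      (measurable_fst.comp (measurable_pi_apply (Fin.last t)))).aestronglyMeasurable
      (∑ i, |f i|) (ae_of_all _ fun p =>
      Finset.single_le_sum (f := fun i => |f i|) (fun _ _ => abs_nonneg _) (Finset.mem_univ _))
  refine ⟨hi, ?_⟩
  rw [← hmp.map_eq, integral_map hmp.measurable.aemeasurable
    (measurable_armSum f).aestronglyMeasurable, ← integral_add _ hi]
  · simp [armSum, Fin.sum_univ_castSucc]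
  · exact hmp.integrable_comp_of_integrable (integrable_armSum f _)

/-- Each reward is drawn after its arm is chosen, so it averages to that arm's mean. Integrability
is carried along because Gaussian rewards are unbounded and the induction splits the integral. -/
theorem integral_reward {K : ℕ} (G : SimpleGraph (Fin K)) (μ : Fin K → ℝ) (A : Algorithm K)
    (t : ℕ) :
    Integrable (fun h : History K t => ∑ u, (h u).2 (h u).1) (law G μ A t) ∧
      ∫ h, ∑ u, (h u).2 (h u).1 ∂(law G μ A t) = ∫ h, armSum μ h ∂(law G μ A t) := by
  induction t with
  | zero => simp [armSum]
  | succ t ih =>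
    have hmp := measurePreserving_init G μ A t
    have hi := hmp.integrable_comp_of_integrable ih.1
    have hl := integrable_lastReward G μ A t
    have hsum : (fun h : History K (t + 1) => ∑ u, (h u).2 (h u).1) =
        fun h => ((fun h : History K t => ∑ u, (h u).2 (h u).1) ∘
          fun (h : History K (t + 1)) (u : Fin t) => h u.castSucc) h +
            (h (Fin.last t)).2 (h (Fin.last t)).1 := by
      ext h
      simp [Fin.sum_univ_castSucc]
    rw [hsum]
    refine ⟨hi.add hl, ?_⟩
    rw [integral_add hi hl, (integral_armSum_succ G μ A t μ).2, integral_lastReward, ← ih.2]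
    congr 1
    conv_rhs => rw [← hmp.map_eq]
    rw [integral_map hmp.measurable.aemeasurable]
    · rfl
    · rw [hmp.map_eq]
      exact ih.1.aestronglyMeasurable

theorem regret_eq {K : ℕ} (G : SimpleGraph (Fin K)) (μ : Fin K → ℝ) (A : Algorithm K) (T : ℕ) :
    regret G μ A T = ∫ h, armSum (gap μ) h ∂(law G μ A T) := by
  rw [regret, (integral_reward G μ A T).2]
  have : ∀ h : History K T, armSum (gap μ) h = T * bestMean μ - armSum μ h := by
    intro h
    simp [armSum, gap]
  simp_rw [this]
  rw [integral_sub (integrable_const _) (integrable_armSum μ _)]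
  simp

theorem gap_nonneg {K : ℕ} (μ : Fin K → ℝ) (i : Fin K) : 0 ≤ gap μ i :=
  sub_nonneg.2 (le_ciSup (Set.finite_range μ).bddAbove i)

theorem monotone_regret {K : ℕ} (G : SimpleGraph (Fin K)) (μ : Fin K → ℝ) (A : Algorithm K) :
    Monotone (regret G μ A) := by
  refine monotone_nat_of_le_succ fun t => ?_
  rw [regret_eq, regret_eq, (integral_armSum_succ G μ A t _).2]
  exact le_add_of_nonneg_right (integral_nonneg fun h => gap_nonneg μ _)

/-! ### Indistinguishable instances -/

/-- The noise terms are odd in `δ` and cancel; the quadratic terms remain, once per round in which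
`i` is observed. Symmetry of adjacency turns these rounds into plays in the neighbourhood of `i`. -/
theorem historyLogRatio_add_neg {K t : ℕ} (G : SimpleGraph (Fin K)) (i : Fin K) (m δ : ℝ)
    (h : History K t) :
    historyLogRatio G i m δ h + historyLogRatio G i m (-δ) h =
      -(δ ^ 2 * √2) * playCount (nbhd G i) h := by
  classical
  rw [historyLogRatio, historyLogRatio, ← Finset.sum_add_distrib, playCount, armSum,
    Finset.mul_sum]
  refine Finset.sum_congr rfl fun u _ => ?_
  have : i ∈ nbhd G (h u).1 ↔ (h u).1 ∈ (nbhd G i : Set (Fin K)) := by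
    simp [nbhd, eq_comm, G.adj_comm]
  by_cases hi : i ∈ nbhd G (h u).1
  · simp only [logRatio, if_pos hi, if_pos (this.1 hi)]
    ring
  · simp only [logRatio, if_neg hi, if_neg (mt this.2 hi)]
    ring

/-- The ratio for `δ` can be small only if `i` is observed often or the ratio for `-δ` is large.
Markov's inequality excludes both outside an event of probability `1 / 8 + 1 / 4`, which leaves at
least `1 / 8` of `E`. -/
theorem law_update_real_ge {K : ℕ} (G : SimpleGraph (Fin K)) (μ : Fin K → ℝ) (A : Algorithm K)
    (i : Fin K) (δ : ℝ) (t : ℕ) {E : Set (History K t)} (hE : MeasurableSet E)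
    (hN : δ ^ 2 * ∫ h, playCount (nbhd G i) h ∂(law G μ A t) ≤ 1)
    (hP : 1 / 2 ≤ (law G μ A t).real E) :
    Real.exp (-12) / 32 ≤ (law G (Function.update μ i (μ i + δ)) A t).real E := by
  set P := law G μ A t with hPdef
  set N : History K t → ℝ := playCount (nbhd G i)
  have hNm : Measurable N := measurable_playCount _
  have hRm : Measurable (historyLogRatio (t := t) G i (μ i) (-δ)) := measurable_historyLogRatio ..
  set B₁ : Set (History K t) := {h | 8 ≤ δ ^ 2 * N h}
  set B₂ : Set (History K t) := {h | 4 ≤ Real.exp (historyLogRatio G i (μ i) (-δ) h)}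
  have hB₁m : MeasurableSet B₁ := measurableSet_le measurable_const (hNm.const_mul _)
  have hB₂m : MeasurableSet B₂ := measurableSet_le measurable_const hRm.exp
  have hB₁ : P.real B₁ ≤ 1 / 8 := by
    have := mul_meas_ge_le_integral_of_nonneg (μ := P) (f := fun h => δ ^ 2 * N h)
      (ae_of_all _ fun h => mul_nonneg (sq_nonneg _) (playCount_nonneg _ _))
      ((integrable_playCount _ P).const_mul _) 8
    rw [integral_const_mul] at this
    change 8 * P.real B₁ ≤ _ at this
    linarith
  -- The ratio for `-δ` has integral `1`, being the density of the law with arm `i` lowered. That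
  -- instance is auxiliary, so its means may leave `[0, 1]`.
  have hB₂ : P.real B₂ ≤ 1 / 4 := by
    have h1 := lintegral_law_update G μ A i (-δ) t (F := fun _ => 1) measurable_const
    simp only [lintegral_const, measure_univ, one_mul] at h1
    have h2 := mul_meas_ge_le_lintegral (μ := P) hRm.exp.ennreal_ofReal (ENNReal.ofReal 4)
    rw [← h1] at h2
    have h3 : {h | ENNReal.ofReal 4 ≤ ENNReal.ofReal (Real.exp (historyLogRatio G i (μ i) (-δ) h))}
        = B₂ := by
      ext h
      exact ENNReal.ofReal_le_ofReal_iff (Real.exp_nonneg _)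
    rw [h3] at h2
    have h4 := ENNReal.toReal_mono ENNReal.one_ne_top h2
    rw [ENNReal.toReal_mul, ENNReal.toReal_ofReal (by norm_num), ENNReal.toReal_one] at h4
    change 4 * P.real B₂ ≤ 1 at h4
    linarith
  have hS : 1 / 8 ≤ P.real (E \ (B₁ ∪ B₂)) := by
    have h1 : P.real E ≤ P.real (E \ (B₁ ∪ B₂)) + P.real (B₁ ∪ B₂) :=
      (measureReal_mono (by rw [Set.sdiff_union_self]; exact Set.subset_union_left)).trans
        (measureReal_union_le _ _)
    have h2 := measureReal_union_le (μ := P) B₁ B₂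
    linarith
  have hSm : MeasurableSet (E \ (B₁ ∪ B₂)) := hE.diff (hB₁m.union hB₂m)
  have hL : ∀ h ∈ E \ (B₁ ∪ B₂),
      Real.exp (-12) / 4 ≤ Real.exp (historyLogRatio G i (μ i) δ h) := by
    intro h hh
    have h1 : δ ^ 2 * N h < 8 := not_le.1 fun hc => hh.2 (Or.inl hc)
    have h2 : Real.exp (historyLogRatio G i (μ i) (-δ) h) < 4 :=
      not_le.1 fun hc => hh.2 (Or.inr hc)
    have h3 := historyLogRatio_add_neg G i (μ i) δ h
    have h4 : √2 ≤ 3 / 2 := by rw [Real.sqrt_le_left (by norm_num)]; norm_num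
    have h5 : 0 ≤ δ ^ 2 * N h := mul_nonneg (sq_nonneg _) (playCount_nonneg _ _)
    -- `12 = 8 * (3 / 2)`, from the bounds on `δ ^ 2 * N h` and `√2`.
    have h6 : -12 ≤ historyLogRatio G i (μ i) δ h + historyLogRatio G i (μ i) (-δ) h := by
      rw [h3]
      have : -(δ ^ 2 * √2) * playCount (nbhd G i) h = -(√2 * (δ ^ 2 * N h)) := by ring
      rw [this]
      nlinarith [Real.sqrt_nonneg 2]
    have h7 := Real.exp_le_exp.2 h6
    rw [Real.exp_add] at h7
    rw [div_le_iff₀ (by norm_num)]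
    exact h7.trans (by gcongr)
  have hQ := lintegral_law_update G μ A i δ t (F := E.indicator 1) (measurable_one.indicator hE)
  rw [lintegral_indicator_one hE] at hQ
  have hfin : ENNReal.ofReal (Real.exp (-12) / 4) * P (E \ (B₁ ∪ B₂)) ≤
      law G (Function.update μ i (μ i + δ)) A t E := by
    rw [hQ, ← lintegral_indicator_const hSm]
    refine lintegral_mono fun h => ?_
    by_cases hh : h ∈ E \ (B₁ ∪ B₂)
    · rw [Set.indicator_of_mem hh, Set.indicator_of_mem hh.1]
      simpa using ENNReal.ofReal_le_ofReal (hL h hh)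
    · rw [Set.indicator_of_notMem hh]
      exact zero_le
  have hfin' := ENNReal.toReal_mono (measure_ne_top _ _) hfin
  rw [ENNReal.toReal_mul, ENNReal.toReal_ofReal (by positivity)] at hfin'
  change _ * P.real _ ≤ Measure.real _ E at hfin'
  refine le_trans ?_ hfin'
  nlinarith [Real.exp_pos (-12)]

/-! ### Regret lower bounds from play counts -/

theorem bestMean_eq {K : ℕ} {μ : Fin K → ℝ} {i : Fin K} (hi : ∀ j, μ j ≤ μ i) :
    bestMean μ = μ i :=
  haveI : Nonempty (Fin K) := ⟨i⟩
  le_antisymm (ciSup_le hi) (le_ciSup (Set.finite_range μ).bddAbove i)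

/-- If arm `i` beats the others by `g`, then the regret is at least `g * T / 2` times the
probability that `i` is played at most half of the time. -/
theorem regret_ge_of_play_le_half {K : ℕ} (G : SimpleGraph (Fin K)) (μ : Fin K → ℝ)
    (A : Algorithm K) (T : ℕ) {i : Fin K} {g : ℝ} (hg : 0 ≤ g) (hi : ∀ j, j ≠ i → μ j + g ≤ μ i) :
    g * T / 2 * (law G μ A T).real {h | playCount {i} h ≤ (T : ℝ) / 2} ≤ regret G μ A T := by
  have hbest : bestMean μ = μ i := bestMean_eq fun j => by
    by_cases hj : j = i
    · rw [hj]
    · linarith [hi j hj]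
  have hE : MeasurableSet {h : History K T | playCount {i} h ≤ (T : ℝ) / 2} :=
    measurableSet_le (measurable_playCount _) measurable_const
  rw [regret_eq, mul_comm, ← smul_eq_mul, ← integral_indicator_const _ hE]
  refine integral_mono ((integrable_const _).indicator hE) (integrable_armSum _ _) fun h => ?_
  by_cases hh : h ∈ {h : History K T | playCount {i} h ≤ (T : ℝ) / 2}
  · simp only [Set.indicator_of_mem hh]
    have h1 : g * (T - playCount {i} h) ≤ armSum (gap μ) h := by
      have : g * (T - playCount {i} h) = armSum (fun j => if j = i then 0 else g) h := by
        classical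
        have h2 : ∀ j : Fin K, (if j = i then 0 else g) = g - g * if j = i then 1 else 0 := by
          intro j; split_ifs <;> ring
        simp only [armSum, playCount, h2, Finset.sum_sub_distrib, ← Finset.mul_sum]
        simp
        ring
      rw [this]
      refine armSum_mono (fun j => ?_) h
      split_ifs with hj
      · exact gap_nonneg μ j
      · rw [gap, hbest]
        linarith [hi j hj]
    have h3 : playCount {i} h ≤ (T : ℝ) / 2 := hh
    nlinarith
  · simp only [Set.indicator_of_notMem hh]
    exact armSum_nonneg (gap_nonneg μ) h

theorem gap_mul_integral_playCount_le_regret {K : ℕ} (G : SimpleGraph (Fin K)) (μ : Fin K → ℝ)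
    (A : Algorithm K) (T : ℕ) (j : Fin K) :
    gap μ j * ∫ h, playCount {j} h ∂(law G μ A T) ≤ regret G μ A T := by
  rw [regret_eq, integral_armSum]
  exact Finset.single_le_sum (f := fun j => gap μ j * ∫ h, playCount {j} h ∂(law G μ A T))
    (fun i _ => mul_nonneg (gap_nonneg μ i) (integral_nonneg fun h => playCount_nonneg _ _))
    (Finset.mem_univ j)

theorem mul_measureReal_lt_playCount_le {K T : ℕ} (P : Measure (History K T))
    [IsFiniteMeasure P] (i : Fin K) {a : ℝ} (ha : 0 ≤ a) :
    a * P.real {h | playCount {i} h ≤ a}ᶜ ≤ ∫ h, playCount {i} h ∂P := by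
  refine le_trans ?_ (mul_meas_ge_le_integral_of_nonneg (μ := P)
    (ae_of_all _ fun h => playCount_nonneg {i} h) (integrable_playCount _ P) a)
  gcongr
  · exact measure_ne_top _ _
  · intro h hh
    exact (lt_of_not_ge (show ¬playCount {i} h ≤ a from hh)).le

/-! ### The linear program and the confusing instances -/

theorem lpValue_nonneg {K : ℕ} (G : SimpleGraph (Fin K)) (μ : Fin K → ℝ) (s : ℕ) :
    0 ≤ lpValue G μ s := by
  refine Real.sInf_nonneg ?_
  rintro _ ⟨x, hx, rfl⟩
  exact Finset.sum_nonneg fun i _ =>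
    mul_nonneg ((scale_pos s).le.trans (le_max_left _ _)) (hx.1 i)

theorem le_bestMean {K : ℕ} (μ : Fin K → ℝ) (i : Fin K) : μ i ≤ bestMean μ :=
  le_ciSup (Set.finite_range μ).bddAbove i

/-- If the linear program has a large value and a nonnegative vector `x` has a small cost outside
an optimal arm, then `x` undersamples the neighbourhood of some other near-optimal arm. -/
theorem exists_undersampled {K : ℕ} (G : SimpleGraph (Fin K)) (μ : Fin K → ℝ) (s : ℕ)
    {b : Fin K} (hb : μ b = bestMean μ) {x : Fin K → ℝ} (hx : ∀ i, 0 ≤ x i)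
    (hD : 2 / scale s < lpValue G μ s)
    (hcost : 18 * ∑ i ∈ Finset.univ.erase b, clippedGap μ s i * x i ≤ lpValue G μ s) :
    ∃ i ∈ nearOptimal μ s, i ≠ b ∧ 9 * (scale s ^ 2 * ∑ j ∈ nbhd G i, x j) ≤ 1 := by
  classical
  have hs := scale_pos s
  set z : Fin K → ℝ := fun i => if i = b then 1 / scale s ^ 2 else 9 * x i with hz
  have hz0 : ∀ i, 0 ≤ z i := by
    intro i
    simp only [hz]
    split_ifs
    · positivity
    · linarith [hx i]
  have hzcost : ∑ i, clippedGap μ s i * z i < lpValue G μ s := by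
    rw [← Finset.add_sum_erase _ _ (Finset.mem_univ b)]
    have h1 : clippedGap μ s b * z b = 1 / scale s := by
      simp only [hz, clippedGap, gap, hb, sub_self, max_eq_left hs.le, if_true]
      field_simp
    have h2 : ∑ i ∈ Finset.univ.erase b, clippedGap μ s i * z i =
        9 * ∑ i ∈ Finset.univ.erase b, clippedGap μ s i * x i := by
      rw [Finset.mul_sum]
      refine Finset.sum_congr rfl fun i hi => ?_
      simp only [hz, if_neg (Finset.ne_of_mem_erase hi)]
      ring
    have h3 : 2 / scale s = 2 * (1 / scale s) := by ring
    rw [h1, h2]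
    linarith
  have hnf : z ∉ lpFeasible G μ s := fun hf =>
    hzcost.not_ge (csInf_le (lp_bddBelow G μ s) ⟨z, hf, rfl⟩)
  obtain ⟨i, hi, hlt⟩ : ∃ i ∈ nearOptimal μ s, ∑ j ∈ nbhd G i, z j < 1 / scale s ^ 2 := by
    by_contra hcon
    push Not at hcon
    exact hnf ⟨hz0, hcon⟩
  -- The weight on `b` alone meets the constraint of each of its neighbours. So the violated
  -- constraint does not involve the plays of `b`, which the regret does not control.
  have hbi : b ∉ nbhd G i := fun hmem => by
    have := Finset.single_le_sum (f := z) (fun j _ => hz0 j) hmem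
    have h1 : z b = 1 / scale s ^ 2 := by simp [hz]
    linarith
  refine ⟨i, hi, ?_, ?_⟩
  · rintro rfl
    exact hbi (by simp [nbhd])
  · have h1 : ∑ j ∈ nbhd G i, z j = 9 * ∑ j ∈ nbhd G i, x j := by
      rw [Finset.mul_sum]
      refine Finset.sum_congr rfl fun j hj => ?_
      simp only [hz]
      rw [if_neg (by rintro rfl; exact hbi hj)]
    rw [h1, lt_div_iff₀ (by positivity)] at hlt
    linarith

/-- Lifting arm `i` to at most `scale s` above the old best mean costs at most `gap μ i + scale s`,
and each summand is at most the clipped gap. -/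
theorem mem_confusing {K : ℕ} {μ μ' : Fin K → ℝ} {s : ℕ} (hμ : ∀ i, μ i ∈ Set.Icc (0 : ℝ) 1)
    (hb : bestMean μ + 2 * scale s ≤ 1)
    (h : ∀ i, μ' i = μ i ∨ bestMean μ ≤ μ' i ∧ μ' i ≤ bestMean μ + scale s) :
    μ' ∈ confusing μ s := by
  have hs := scale_pos s
  have hc : ∀ i, scale s ≤ clippedGap μ s i ∧ gap μ i ≤ clippedGap μ s i := fun i =>
    ⟨le_max_left _ _, le_max_right _ _⟩
  refine ⟨fun i => ?_, fun i => ?_⟩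
  · rcases h i with h | h
    · rw [h]; exact hμ i
    · exact ⟨by linarith [(hμ i).1, le_bestMean μ i], by linarith⟩
  · have h1 := (hc i).1
    have h2 := (hc i).2
    have h3 := le_bestMean μ i
    rcases h i with h | h
    · rw [h]; exact ⟨le_rfl, by linarith⟩
    · rw [gap] at h2
      exact ⟨by linarith, by linarith⟩

/-! ### The lower bound at a fixed horizon -/

theorem four_pow_eq (s : ℕ) : ((4 ^ s : ℕ) : ℝ) = 1 / scale s ^ 2 := by
  rw [scale, inv_pow, one_div, inv_inv, ← pow_mul, mul_comm, pow_mul]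
  norm_num

/-- Two instances in which the best arm is `b` and `i`, respectively, cannot both be easy. -/
theorem exists_regret_ge_of_small {K : ℕ} (G : SimpleGraph (Fin K)) {μ : Fin K → ℝ} {s : ℕ}
    (hμ : ∀ i, μ i ∈ Set.Icc (0 : ℝ) 1) (hbest : bestMean μ + 2 * scale s ≤ 1)
    {b i : Fin K} (hb : μ b = bestMean μ) (hib : i ≠ b) (A : Algorithm K) :
    ∃ μ' ∈ confusing μ s,
      Real.exp (-12) / 32 / (4 * scale s) ≤ regret G μ' A (4 ^ s) := by
  have hs := scale_pos s
  have hT : ((4 ^ s : ℕ) : ℝ) = 1 / scale s ^ 2 := four_pow_eq s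
  set T : ℕ := 4 ^ s with hTdef
  have hTs : scale s * T = 1 / scale s := by rw [hT]; field_simp
  -- Placing `i` just `scale s / 2` below `b` lets a raise by `scale s` reverse their order. At `T =
  -- 1 / scale s ^ 2`, even observing `i` in every round keeps `δ ^ 2` times the count at `1`.
  set μ₁ : Fin K → ℝ := Function.update (Function.update μ b (bestMean μ + scale s / 2)) i
    (bestMean μ) with hμ₁
  set μ₂ : Fin K → ℝ := Function.update μ₁ i (μ₁ i + scale s) with hμ₂
  have h1i : μ₁ i = bestMean μ := by simp [hμ₁]
  have h1b : μ₁ b = bestMean μ + scale s / 2 := by simp [hμ₁, hib.symm]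
  have h1j : ∀ j, j ≠ i → j ≠ b → μ₁ j = μ j := by
    intro j hj hjb; simp [hμ₁, hj, hjb]
  have h2i : μ₂ i = bestMean μ + scale s := by simp [hμ₂, h1i]
  have h2j : ∀ j, j ≠ i → μ₂ j = μ₁ j := by intro j hj; simp [hμ₂, hj]
  have hm₁ : μ₁ ∈ confusing μ s := mem_confusing hμ hbest fun j => by
    by_cases hj : j = i
    · subst hj; exact Or.inr ⟨h1i.ge, by linarith⟩
    · by_cases hjb : j = b
      · subst hjb; exact Or.inr ⟨by linarith, by linarith⟩
      · exact Or.inl (h1j j hj hjb)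
  have hm₂ : μ₂ ∈ confusing μ s := mem_confusing hμ hbest fun j => by
    by_cases hj : j = i
    · subst hj; exact Or.inr ⟨by linarith, by linarith⟩
    · rw [h2j j hj]
      by_cases hjb : j = b
      · subst hjb; exact Or.inr ⟨by linarith, by linarith⟩
      · exact Or.inl (h1j j hj hjb)
  set E : Set (History K T) := {h | playCount {i} h ≤ (T : ℝ) / 2} with hEdef
  have hE : MeasurableSet E := measurableSet_le (measurable_playCount _) measurable_const
  have hc0 : Real.exp (-12) ≤ 1 := Real.exp_le_one_iff.2 (by norm_num)
  rcases le_total (1 / 2) ((law G μ₁ A T).real E) with hP | hP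
  · refine ⟨μ₂, hm₂, ?_⟩
    have hN : scale s ^ 2 * ∫ h, playCount (nbhd G i) h ∂(law G μ₁ A T) ≤ 1 := by
      have h1 : ∫ h, playCount (nbhd G i) h ∂(law G μ₁ A T) ≤ T := by
        have := integral_mono (integrable_playCount (nbhd G i) (law G μ₁ A T))
          (integrable_const (T : ℝ)) fun h => playCount_le _ h
        simpa using this
      calc _ ≤ scale s ^ 2 * T := by gcongr
        _ = 1 := by rw [hT]; field_simp
    have hQ := law_update_real_ge G μ₁ A i (scale s) T hE hN hP
    have hreg := regret_ge_of_play_le_half G μ₂ A T (i := i) (g := scale s / 2) (by positivity)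
      fun j hj => by
        rw [h2i, h2j j hj]
        by_cases hjb : j = b
        · subst hjb; linarith
        · rw [h1j j hj hjb]; linarith [le_bestMean μ j]
    refine le_trans ?_ hreg
    calc Real.exp (-12) / 32 / (4 * scale s)
        = 1 / scale s / 4 * (Real.exp (-12) / 32) := by field_simp
      _ = scale s / 2 * T / 2 * (Real.exp (-12) / 32) := by rw [← hTs]; ring
      _ ≤ _ := by gcongr
  · refine ⟨μ₁, hm₁, ?_⟩
    have hEc : 1 / 2 ≤ (law G μ₁ A T).real Eᶜ := by
      rw [probReal_compl_eq_one_sub hE]; linarith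
    have hM := mul_measureReal_lt_playCount_le (law G μ₁ A T) i (a := (T : ℝ) / 2) (by positivity)
    have hreg := gap_mul_integral_playCount_le_regret G μ₁ A T i
    have hgap : gap μ₁ i = scale s / 2 := by
      have : bestMean μ₁ = μ₁ b := bestMean_eq fun j => by
        by_cases hj : j = i
        · subst hj; linarith
        · by_cases hjb : j = b
          · rw [hjb]
          · rw [h1j j hj hjb]; linarith [le_bestMean μ j]
      rw [gap, this]
      linarith
    rw [hgap] at hreg
    refine le_trans ?_ hreg
    calc Real.exp (-12) / 32 / (4 * scale s)
        = 1 / scale s / 4 * (Real.exp (-12) / 32) := by field_simp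
      _ ≤ 1 / scale s / 4 * (1 / 2) := by gcongr; linarith
      _ = scale s / 2 * (T / 2 * (1 / 2)) := by rw [← hTs]; ring
      _ ≤ scale s / 2 * (T / 2 * (law G μ₁ A T).real Eᶜ) := by gcongr
      _ ≤ _ := by gcongr

theorem exists_regret_ge_of_large {K : ℕ} (G : SimpleGraph (Fin K)) {μ : Fin K → ℝ} {s : ℕ}
    (hμ : ∀ i, μ i ∈ Set.Icc (0 : ℝ) 1) (hbest : bestMean μ + 2 * scale s ≤ 1)
    {b : Fin K} (hb : μ b = bestMean μ) (hD : 2 / scale s < lpValue G μ s) (A : Algorithm K)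
    {T : ℕ} (hT : lpValue G μ s / scale s ≤ T) :
    ∃ μ' ∈ confusing μ s, Real.exp (-12) / 256 * lpValue G μ s ≤ regret G μ' A T := by
  classical
  have hs := scale_pos s
  have hc0 : Real.exp (-12) ≤ 1 := Real.exp_le_one_iff.2 (by norm_num)
  set D := lpValue G μ s with hDdef
  have hDpos : 0 < D := lt_trans (by positivity) hD
  have hDT : D ≤ scale s * T := by rwa [div_le_iff₀' hs] at hT
  have hTpos : (0 : ℝ) < T := by
    by_contra hcon
    nlinarith
  set ν : Fin K → ℝ := Function.update μ b (bestMean μ + scale s / 2) with hν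
  have hνb : ν b = bestMean μ + scale s / 2 := by simp [hν]
  have hνj : ∀ j, j ≠ b → ν j = μ j := by intro j hj; simp [hν, hj]
  have hνm : ν ∈ confusing μ s := mem_confusing hμ hbest fun j => by
    by_cases hj : j = b
    · subst hj; exact Or.inr ⟨by linarith, by linarith⟩
    · exact Or.inl (hνj j hj)
  by_cases hreg : Real.exp (-12) / 256 * D ≤ regret G ν A T
  · exact ⟨ν, hνm, hreg⟩
  have hreg' : 256 * regret G ν A T < D := by nlinarith
  have hνbest : bestMean ν = ν b := bestMean_eq fun j => by
    by_cases hj : j = b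
    · rw [hj]
    · rw [hνj j hj]; linarith [le_bestMean μ j]
  have hgap : ∀ j, j ≠ b → gap ν j = gap μ j + scale s / 2 := by
    intro j hj
    rw [gap, gap, hνbest, hνj j hj, hνb]
    ring
  set x : Fin K → ℝ := fun j => ∫ h, playCount {j} h ∂(law G ν A T) with hxdef
  have hx : ∀ j, 0 ≤ x j := fun j => integral_nonneg fun h => playCount_nonneg _ _
  have hcost : 18 * ∑ i ∈ Finset.univ.erase b, clippedGap μ s i * x i ≤ D := by
    have h1 : regret G ν A T = ∑ j, gap ν j * x j := by rw [regret_eq, integral_armSum]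
    have h2 : ∑ j ∈ Finset.univ.erase b, gap ν j * x j ≤ ∑ j, gap ν j * x j :=
      Finset.sum_le_sum_of_subset_of_nonneg (Finset.erase_subset _ _)
        fun j _ _ => mul_nonneg (gap_nonneg ν j) (hx j)
    have h3 : ∑ i ∈ Finset.univ.erase b, clippedGap μ s i * x i ≤
        ∑ i ∈ Finset.univ.erase b, 2 * (gap ν i * x i) := by
      refine Finset.sum_le_sum fun i hi => ?_
      rw [← mul_assoc]
      refine mul_le_mul_of_nonneg_right ?_ (hx i)
      rw [hgap i (Finset.ne_of_mem_erase hi)]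
      have := gap_nonneg μ i
      exact max_le (by linarith) (by linarith)
    rw [← Finset.mul_sum] at h3
    linarith
  obtain ⟨i, hi, hib, hundersampled⟩ := exists_undersampled G μ s hb hx hD hcost
  have hi' : gap μ i ≤ 2 * scale s := hi
  -- This puts `i` above `b` by `scale s / 2`. Near-optimality gives `δ ≤ 3 * scale s`, whose square
  -- accounts for the factor `9` in `exists_undersampled`.
  set δ : ℝ := gap μ i + scale s with hδ
  have hδ0 : 0 ≤ δ := add_nonneg (gap_nonneg μ i) hs.le
  set ν' : Fin K → ℝ := Function.update ν i (ν i + δ) with hν'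
  have hν'i : ν' i = bestMean μ + scale s := by
    simp only [hν', Function.update_self, hνj i hib, hδ, gap]
    ring
  have hν'j : ∀ j, j ≠ i → ν' j = ν j := by intro j hj; simp [hν', hj]
  refine ⟨ν', mem_confusing hμ hbest fun j => ?_, ?_⟩
  · by_cases hj : j = i
    · subst hj; exact Or.inr ⟨by linarith, by linarith⟩
    · rw [hν'j j hj]
      by_cases hjb : j = b
      · subst hjb; exact Or.inr ⟨by linarith, by linarith⟩
      · exact Or.inl (hνj j hjb)
  set E : Set (History K T) := {h | playCount {i} h ≤ (T : ℝ) / 2} with hEdef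
  have hE : MeasurableSet E := measurableSet_le (measurable_playCount _) measurable_const
  have hN : δ ^ 2 * ∫ h, playCount (nbhd G i) h ∂(law G ν A T) ≤ 1 := by
    rw [integral_playCount_coe]
    have h1 : 0 ≤ ∑ j ∈ nbhd G i, x j := Finset.sum_nonneg fun j _ => hx j
    have h2 : δ ^ 2 ≤ 9 * scale s ^ 2 := by nlinarith
    calc δ ^ 2 * ∑ j ∈ nbhd G i, x j ≤ 9 * scale s ^ 2 * ∑ j ∈ nbhd G i, x j := by gcongr
      _ ≤ 1 := by rwa [mul_assoc]
  have hP : 1 / 2 ≤ (law G ν A T).real E := by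
    have h1 := gap_mul_integral_playCount_le_regret G ν A T i
    have h2 : scale s / 2 ≤ gap ν i := by rw [hgap i hib]; linarith [gap_nonneg μ i]
    have h3 : scale s / 2 * x i ≤ regret G ν A T :=
      (mul_le_mul_of_nonneg_right h2 (hx i)).trans h1
    -- Each play of `i` costs at least `scale s / 2`, while the regret is below `D / 256` and `D ≤
    -- scale s * T`.
    have h4 : 128 * x i ≤ T := by
      have : scale s * (128 * x i) ≤ scale s * T := by linarith
      exact le_of_mul_le_mul_left this hs
    have h5 := mul_measureReal_lt_playCount_le (law G ν A T) i (a := (T : ℝ) / 2) (by positivity)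
    change T / 2 * (law G ν A T).real Eᶜ ≤ x i at h5
    rw [probReal_compl_eq_one_sub hE] at h5
    by_contra hcon
    nlinarith
  have hQ := law_update_real_ge G ν A i δ T hE hN hP
  have hregret := regret_ge_of_play_le_half G ν' A T (i := i) (g := scale s / 2) (by positivity)
    fun j hj => by
      rw [hν'i, hν'j j hj]
      by_cases hjb : j = b
      · subst hjb; linarith
      · rw [hνj j hjb]; linarith [le_bestMean μ j]
  refine le_trans ?_ hregret
  have hexp := Real.exp_pos (-12)
  calc Real.exp (-12) / 256 * D ≤ Real.exp (-12) / 256 * (scale s * T) := by gcongr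
    _ = scale s / 2 * T / 2 * (Real.exp (-12) / 64) := by ring
    _ ≤ scale s / 2 * T / 2 * (Real.exp (-12) / 32) := by gcongr; norm_num
    _ ≤ _ := by gcongr

end FeedbackGraph

end

theorem mainTheorem3 :
    ∃ c C : ℝ, 0 < c ∧ 0 < C ∧
      ∀ (K : ℕ), 2 ≤ K → ∀ (G : SimpleGraph (Fin K)) (μ : Fin K → ℝ) (s : ℕ),
        (∀ i, μ i ∈ Set.Icc (0 : ℝ) 1) →
        (∀ i ∈ FeedbackGraph.optimalArms μ, μ i ≤ 1 - 2 * FeedbackGraph.scale s) →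
        ∀ A : FeedbackGraph.Algorithm K,
          ∃ μ' ∈ FeedbackGraph.confusing μ s, ∀ T : ℕ,
            C * (FeedbackGraph.lpValue G μ s / FeedbackGraph.scale s
                + 1 / FeedbackGraph.scale s ^ 2) ≤ T →
              c * FeedbackGraph.lpValue G μ s ≤ FeedbackGraph.regret G μ' A T := by
  -- The constant is set by the case `D ≤ 2 / scale s`, where it is matched exactly; the other case
  -- has a factor of two to spare.
  refine ⟨Real.exp (-12) / 256, 1, by positivity, one_pos, ?_⟩
  intro K hK G μ s hμ hopt A
  have hs := FeedbackGraph.scale_pos s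
  have : Nontrivial (Fin K) := Fin.nontrivial_iff_two_le.2 hK
  obtain ⟨b, hb⟩ : ∃ b, μ b = FeedbackGraph.bestMean μ :=
    (Set.finite_range μ).isCompact.sSup_mem (Set.range_nonempty μ)
  have hbest : FeedbackGraph.bestMean μ + 2 * FeedbackGraph.scale s ≤ 1 := by
    have := hopt b hb
    linarith
  have hD0 := FeedbackGraph.lpValue_nonneg G μ s
  set D := FeedbackGraph.lpValue G μ s with hD
  -- Above this threshold, the cost `1 / scale s` of covering `b` is less than half of `D`.
  rcases le_or_gt D (2 / FeedbackGraph.scale s) with hsmall | hlarge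
  · obtain ⟨i, hib⟩ := exists_ne b
    obtain ⟨μ', hμ', hreg⟩ :=
      FeedbackGraph.exists_regret_ge_of_small G hμ hbest hb hib A
    refine ⟨μ', hμ', fun T hT => ?_⟩
    have h4 : ((4 ^ s : ℕ) : ℝ) = 1 / FeedbackGraph.scale s ^ 2 :=
      FeedbackGraph.four_pow_eq s
    have hT4 : 4 ^ s ≤ T := by
      have : 0 ≤ D / FeedbackGraph.scale s := by positivity
      have : ((4 ^ s : ℕ) : ℝ) ≤ T := by rw [h4]; linarith
      exact_mod_cast this
    calc Real.exp (-12) / 256 * D ≤ Real.exp (-12) / 256 * (2 / FeedbackGraph.scale s) := by gcongr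
      _ = Real.exp (-12) / 32 / (4 * FeedbackGraph.scale s) := by field_simp; norm_num
      _ ≤ _ := hreg
      _ ≤ _ := FeedbackGraph.monotone_regret G μ' A hT4
  · obtain ⟨μ', hμ', hreg⟩ := FeedbackGraph.exists_regret_ge_of_large G hμ hbest hb hlarge A
      (Nat.le_ceil (D / FeedbackGraph.scale s))
    refine ⟨μ', hμ', fun T hT => hreg.trans (FeedbackGraph.monotone_regret G μ' A ?_)⟩
    refine Nat.ceil_le.2 ?_
    have : 0 ≤ 1 / FeedbackGraph.scale s ^ 2 := by positivity
    linarith
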